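/- Let $M$ be a smooth $3$-dimensional Riemannian manifold with boundary $\partial M$, let $\nu$ be the inward pointing unit normal field along $\partial M$, and let $\nabla$ be the Levi-Civita connection of $M$. For $p\in\partial M$ let $B(x,y)=(\nabla_xY)^N$ be the second fundamental form of $\partial M\subset M$ (for $x,y\in T_p\partial M$, with $Y$ any local extension of $y$ tangent to $\partial M$, and $N$ denoting the component normal to $\partial M$), let $S_\eta:T_p\partial M\to T_p\partial M$ be given by $\langle S_\eta x,y\rangle=\langle B(x,y),\eta\rangle$, and let $$H(p)=\frac1{\dim\partial M}\,\mathrm{tr}(S_{-\nu})$$ be the mean curvature of $\partial M$ with respect to the outward unit normal $-\nu$. A smooth chart $(x_1,x_2,x_3)$ of the manifold with boundary $M$, with values in the half space $\{x_3\ge 0\}$, is called a Type A coordinate system if (A1) on $\partial M$, $\partial/\partial x_3$ is orthogonal to $\partial/\partial x_1$ and $\partial/\partial x_2$; (A2) $\partial/\partial x_3$ has norm $1$ everywhere on the domain of the chart; and (A3) on $\partial M$, $\partial/\partial x_3$ is the inward pointing normal vector. For such a chart put $g_{ij}=\langle\partial/\partial x_i,\partial/\partial x_j\rangle$, $a=\sqrt{\det(g_{ij})}$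 and, at points of $\partial M$ in the domain of the chart, $\tau=\frac{\partial a}{\partial x_3}\cdot\frac1a$. Then, in every Type A coordinate system and at every point of $\partial M$ in its domain, $a>0$, $a$ is differentiable, and $$H=\tfrac12\,\tau .$$ Consequently $\tau$ is globally well defined on $\partial M$: any two Type A coordinate systems give the same value of $\tau$ at every point of $\partial M$ that lies in both domains. -/

import Mathlib

open Bundle Set
open scoped Manifold ContDiff Topology

set_option linter.unusedSectionVars false

noncomputable section

namespace RiemannianBoundary

section LeviCivita

variable {E : Type*} [NormedAddCommGroup E] [NormedSpace ℝ E] [FiniteDimensional ℝ E]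
  {H : Type*} [TopologicalSpace H] (I : ModelWithCorners ℝ E H)
  {M : Type*} [TopologicalSpace M] [ChartedSpace H M]
  [RiemannianBundle (fun x : M => TangentSpace I x)]

/-- The right-hand side of the Koszul formula for `⟨∇_X Y, Z⟩`. -/
def koszul (Y X Z : Π x : M, TangentSpace I x) (p : M) : ℝ :=
  (1 / 2) * (d% (fun q => inner ℝ (Y q) (Z q)) p (X p)
    + d% (fun q => inner ℝ (X q) (Z q)) p (Y p)
    - d% (fun q => inner ℝ (X q) (Y q)) p (Z p)
    + inner ℝ (VectorField.mlieBracket I X Y p) (Z p)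
    - inner ℝ (VectorField.mlieBracket I X Z p) (Y p)
    - inner ℝ (VectorField.mlieBracket I Y Z p) (X p))

variable [IsManifold I ∞ M] [IsContMDiffRiemannianBundle I ∞ E (fun x : M => TangentSpace I x)]

variable {I}

instance (p : M) : FiniteDimensional ℝ (TangentSpace I p) :=
  inferInstanceAs (FiniteDimensional ℝ E)

theorem mdifferentiableAt_inner {X Y : Π x : M, TangentSpace I x} {p : M}
    (hX : MDiffAt (T% X) p) (hY : MDiffAt (T% Y) p) :
    MDiffAt (fun q => inner ℝ (X q) (Y q)) p :=
  MDifferentiableAt.inner_bundle (E := fun x : M => TangentSpace I x) (F := E) (IB := I)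
    (b := fun q => q) hX hY

theorem koszul_tensorial_left {Y Z : Π x : M, TangentSpace I x} {p : M}
    (hY : MDiffAt (T% Y) p) (hZ : MDiffAt (T% Z) p) :
    TensorialAt I E (fun X => koszul I Y X Z p) p where
  smul := by
    intro f X hf hX
    simp [koszul, VectorField.mlieBracket_smul_left hf hX,
      mvfderiv_fun_mul hf (mdifferentiableAt_inner hX hZ), mvfderiv_fun_mul hf (mdifferentiableAt_inner hX hY),
      inner_add_left, inner_smul_left, inner_smul_right]
    ring
  add := by
    intro X X' hX hX'
    simp [koszul, VectorField.mlieBracket_add_left hX hX',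
      mvfderiv_fun_add (mdifferentiableAt_inner hX hZ) (mdifferentiableAt_inner hX' hZ),
      mvfderiv_fun_add (mdifferentiableAt_inner hX hY) (mdifferentiableAt_inner hX' hY),
      inner_add_left, inner_add_right]
    ring

theorem koszul_tensorial_right {Y X : Π x : M, TangentSpace I x} {p : M}
    (hY : MDiffAt (T% Y) p) (hX : MDiffAt (T% X) p) :
    TensorialAt I E (fun Z => koszul I Y X Z p) p where
  smul := by
    intro f Z hf hZ
    simp [koszul, VectorField.mlieBracket_smul_right hf hZ,
      mvfderiv_fun_mul hf (mdifferentiableAt_inner hX hZ), mvfderiv_fun_mul hf (mdifferentiableAt_inner hY hZ),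
      inner_add_left, inner_smul_left, inner_smul_right]
    rw [real_inner_comm (Y p) (Z p), real_inner_comm (X p) (Z p)]
    ring
  add := by
    intro Z Z' hZ hZ'
    simp [koszul, VectorField.mlieBracket_add_right hZ hZ',
      mvfderiv_fun_add (mdifferentiableAt_inner hX hZ) (mdifferentiableAt_inner hX hZ'),
      mvfderiv_fun_add (mdifferentiableAt_inner hY hZ) (mdifferentiableAt_inner hY hZ'),
      inner_add_left, inner_add_right]
    ring

variable (I) in
open Classical in
/-- The Levi-Civita derivative `∇ Y` at `p`, as the linear map `x ↦ ∇_x Y`: the vector `∇_x Y` is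
determined by `⟨∇_x Y, z⟩ = koszul Y X Z p` for all fields `X`, `Z` with `X p = x`, `Z p = z`. -/
def leviCivitaAt (Y : Π x : M, TangentSpace I x) (p : M) :
    TangentSpace I p →L[ℝ] TangentSpace I p :=
  if hY : MDiffAt (T% Y) p then
    haveI : CompleteSpace (TangentSpace I p) := FiniteDimensional.complete ℝ _
    let B := TensorialAt.mkHom₂ (F := E) (F' := E) (fun X Z => koszul I Y X Z p) p
      (fun _ hZ => koszul_tensorial_left hY hZ) (fun _ hX => koszul_tensorial_right hY hX)
    LinearMap.toContinuousLinearMap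
      { toFun := fun x => (InnerProductSpace.toDual ℝ (TangentSpace I p)).symm (B x)
        map_add' := fun x y => by simp
        map_smul' := fun c x => by simp }
  else 0

theorem inner_leviCivitaAt {X Y Z : Π x : M, TangentSpace I x} {p : M}
    (hX : MDiffAt (T% X) p) (hY : MDiffAt (T% Y) p) (hZ : MDiffAt (T% Z) p) :
    inner ℝ (leviCivitaAt I Y p (X p)) (Z p) = koszul I Y X Z p := by
  rw [leviCivitaAt, dif_pos hY]
  have : CompleteSpace (TangentSpace I p) := FiniteDimensional.complete ℝ _
  simp [TensorialAt.mkHom₂_apply _ _ hX hZ]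

/-- The derivative is determined by its inner products with differentiable fields. -/
theorem leviCivitaAt_ext {p : M} {A B : TangentSpace I p →L[ℝ] TangentSpace I p}
    (h : ∀ X Z : Π x : M, TangentSpace I x, MDiffAt (T% X) p → MDiffAt (T% Z) p →
      inner ℝ (A (X p)) (Z p) = inner ℝ (B (X p)) (Z p)) : A = B := by
  ext x
  refine ext_inner_right ℝ fun z => ?_
  simpa using h (FiberBundle.extend E x) (FiberBundle.extend E z)
    (FiberBundle.mdifferentiableAt_extend ..) (FiberBundle.mdifferentiableAt_extend ..)

variable (I M) in
/-- The Levi-Civita connection of a Riemannian manifold (possibly with boundary). -/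
def leviCivita : CovariantDerivative I E (fun x : M => TangentSpace I x) where
  toFun := leviCivitaAt I
  isCovariantDerivativeOnUniv :=
    { add := by
        intro Y Y' p hY hY' _
        refine leviCivitaAt_ext fun X Z hX hZ => ?_
        have hYY : MDiffAt (T% (Y + Y')) p := mdifferentiableAt_add_section hY hY'
        rw [inner_leviCivitaAt hX hYY hZ]
        simp only [add_apply, inner_add_left, inner_leviCivitaAt hX hY hZ,
          inner_leviCivitaAt hX hY' hZ]
        simp [koszul, VectorField.mlieBracket_add_right hY hY',
          VectorField.mlieBracket_add_left hY hY',
          mvfderiv_fun_add (mdifferentiableAt_inner hX hY) (mdifferentiableAt_inner hX hY'),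
          mvfderiv_fun_add (mdifferentiableAt_inner hY hZ) (mdifferentiableAt_inner hY' hZ),
          inner_add_left, inner_add_right]
        ring
      leibniz := by
        intro Y g p hY hg _
        refine leviCivitaAt_ext fun X Z hX hZ => ?_
        have hgY : MDiffAt (T% (g • Y)) p := hg.smul_section hY
        rw [inner_leviCivitaAt hX hgY hZ]
        simp only [add_apply, inner_add_left, inner_leviCivitaAt hX hY hZ,
          smul_apply, inner_smul_left, ContinuousLinearMap.smulRight_apply]
        simp [koszul, VectorField.mlieBracket_smul_right hg hY,
          VectorField.mlieBracket_smul_left hg hY,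
          mvfderiv_fun_mul hg (mdifferentiableAt_inner hX hY),
          mvfderiv_fun_mul hg (mdifferentiableAt_inner hY hZ),
          inner_add_left, inner_smul_left, inner_smul_right]
        rw [real_inner_comm (X p) (Y p)]
        ring }

theorem inner_leviCivita {X Y Z : Π x : M, TangentSpace I x} {p : M}
    (hX : MDiffAt (T% X) p) (hY : MDiffAt (T% Y) p) (hZ : MDiffAt (T% Z) p) :
    inner ℝ (leviCivita I M Y p (X p)) (Z p) = koszul I Y X Z p :=
  inner_leviCivitaAt hX hY hZ

theorem leviCivita_torsion : (leviCivita I M).torsion = 0 := by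
  rw [CovariantDerivative.torsion_eq_zero_iff]
  intro X Y p hX hY
  refine ext_inner_right ℝ fun z => ?_
  obtain ⟨Z, hZ, rfl⟩ : ∃ Z : Π x : M, TangentSpace I x, MDiffAt (T% Z) p ∧ Z p = z :=
    ⟨FiberBundle.extend E z, FiberBundle.mdifferentiableAt_extend .., by simp⟩
  rw [inner_sub_left, inner_leviCivita hX hY hZ, inner_leviCivita hY hX hZ]
  simp only [koszul, VectorField.mlieBracket_swap_apply (V := Y) (W := X), inner_neg_left]
  simp only [real_inner_comm (X _) (Y _)]
  ring

theorem leviCivita_metric {X Y Z : Π x : M, TangentSpace I x} {p : M}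
    (hX : MDiffAt (T% X) p) (hY : MDiffAt (T% Y) p) (hZ : MDiffAt (T% Z) p) :
    d% (fun q => inner ℝ (Y q) (Z q)) p (X p) =
      inner ℝ (leviCivita I M Y p (X p)) (Z p) + inner ℝ (Y p) (leviCivita I M Z p (X p)) := by
  rw [real_inner_comm _ (Y p), inner_leviCivita hX hY hZ, inner_leviCivita hX hZ hY]
  simp only [koszul, VectorField.mlieBracket_swap_apply (V := Z) (W := Y), inner_neg_left]
  simp only [real_inner_comm (Y _) (Z _)]
  ring

end LeviCivita
section Boundary

variable (n : ℕ) [NeZero n]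
  {M : Type*} [TopologicalSpace M] [ChartedSpace (EuclideanHalfSpace n) M]

/-- The differential at `q` of the coordinate map of the chart centred at `p`. -/
def chartDifferential (p q : M) :
    TangentSpace (𝓡∂ n) q →L[ℝ] EuclideanSpace ℝ (Fin n) :=
  mfderiv (𝓡∂ n) 𝓘(ℝ, EuclideanSpace ℝ (Fin n)) (extChartAt (𝓡∂ n) p) q

/-- The differential at `q` of the coordinate, in the chart centred at `p`, that vanishes on `∂M`
and is positive inside `M`. -/
def boundaryDifferential (p q : M) : TangentSpace (𝓡∂ n) q →L[ℝ] ℝ :=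
  (EuclideanSpace.proj (0 : Fin n) : EuclideanSpace ℝ (Fin n) →L[ℝ] ℝ).comp
    (chartDifferential n p q)

/-- For `p ∈ ∂M`, the tangent space `T_p ∂M` as a subspace of `T_p M`. -/
def boundaryTangent (p : M) : Submodule ℝ (TangentSpace (𝓡∂ n) p) :=
  (boundaryDifferential n p p).ker

variable {n} in
/-- A local extension of `y ∈ T_p M`: the vector field whose components in the chart
centred at `p` are constant. If `y` is tangent to `∂M`, so is the extension along `∂M`. -/
def localExtension {p : M} (y : TangentSpace (𝓡∂ n) p) (q : M) : TangentSpace (𝓡∂ n) q :=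
  (chartDifferential n p q).inverse (chartDifferential n p p y)

variable {n} in
theorem localExtension_add {p : M} (y z : TangentSpace (𝓡∂ n) p) :
    localExtension (y + z) = localExtension y + localExtension z := by
  ext q : 1; simp [localExtension]

variable {n} in
theorem localExtension_smul {p : M} (c : ℝ) (y : TangentSpace (𝓡∂ n) p) :
    localExtension (c • y) = c • localExtension y := by
  ext q : 1; simp [localExtension]

section

variable [IsManifold (𝓡∂ n) ∞ M]

theorem isInvertible_chartDifferential {p q : M}
    (hq : q ∈ (chartAt (EuclideanHalfSpace n) p).source) :
    (chartDifferential n p q).IsInvertible :=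
  isInvertible_mfderiv_extChartAt (I := 𝓡∂ n) (x := p) (y := q) (by simpa using hq)

theorem chartDifferential_self (p : M) :
    chartDifferential n p p = ContinuousLinearMap.id ℝ (EuclideanSpace ℝ (Fin n)) :=
  mfderiv_extChartAt_self

variable {n}

theorem chartDifferential_localExtension {p q : M} (y : TangentSpace (𝓡∂ n) p)
    (hq : q ∈ (chartAt (EuclideanHalfSpace n) p).source) :
    chartDifferential n p q (localExtension y q) = chartDifferential n p p y := by
  obtain ⟨A, hA⟩ := isInvertible_chartDifferential n hq
  simp [localExtension, ← hA]

theorem localExtension_self {p : M} (y : TangentSpace (𝓡∂ n) p) : localExtension y p = y := by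
  obtain ⟨A, hA⟩ := isInvertible_chartDifferential n (mem_chart_source (EuclideanHalfSpace n) p)
  simp [localExtension, ← hA]

theorem trivializationAt_apply_snd {p q : M}
    (hq : q ∈ (chartAt (EuclideanHalfSpace n) p).source) (v : TangentSpace (𝓡∂ n) q) :
    (trivializationAt (EuclideanSpace ℝ (Fin n)) (TangentSpace (𝓡∂ n) : M → Type _) p ⟨q, v⟩).2 =
      chartDifferential n p q v := by
  set t := trivializationAt (EuclideanSpace ℝ (Fin n)) (TangentSpace (𝓡∂ n) : M → Type _) p
  have h := TangentBundle.continuousLinearMapAt_trivializationAt (I := 𝓡∂ n) hq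
  have h2 : t.continuousLinearMapAt ℝ q v = chartDifferential n p q v :=
    congrArg (fun L : TangentSpace (𝓡∂ n) q →L[ℝ] EuclideanSpace ℝ (Fin n) => L v) h
  have hb : q ∈ t.baseSet := by simpa [t] using hq
  exact (t.continuousLinearMapAt_apply_of_mem ℝ hb v).symm.trans h2

theorem localExtension_eq_extend {p q : M} (y : TangentSpace (𝓡∂ n) p)
    (hq : q ∈ (chartAt (EuclideanHalfSpace n) p).source) :
    localExtension y q = FiberBundle.extend (EuclideanSpace ℝ (Fin n)) y q := by
  set t := trivializationAt (EuclideanSpace ℝ (Fin n)) (TangentSpace (𝓡∂ n) : M → Type _) p with htd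
  obtain ⟨A, hA⟩ := isInvertible_chartDifferential n hq
  have hb : q ∈ t.baseSet := by simpa [t] using hq
  have key : chartDifferential n p q (FiberBundle.extend (EuclideanSpace ℝ (Fin n)) y q) =
      chartDifferential n p p y := by
    rw [← trivializationAt_apply_snd hq, ← trivializationAt_apply_snd (mem_chart_source _ p)]
    simp [FiberBundle.extend, t.apply_mk_symm hb, t]
  rw [← chartDifferential_localExtension y hq, ← hA] at key
  exact (A.injective key).symm

theorem mdifferentiableAt_localExtension {p : M} (y : TangentSpace (𝓡∂ n) p) :
    MDifferentiableAt (𝓡∂ n) ((𝓡∂ n).prod 𝓘(ℝ, EuclideanSpace ℝ (Fin n)))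
      (fun q => (⟨q, localExtension y q⟩ : TangentBundle (𝓡∂ n) M)) p := by
  have h := FiberBundle.mdifferentiableAt_extend (𝓡∂ n) (EuclideanSpace ℝ (Fin n)) y
  refine h.congr_of_eventuallyEq ?_
  filter_upwards [chart_source_mem_nhds (EuclideanHalfSpace n) p] with q hq
  rw [localExtension_eq_extend y hq]

end

variable [RiemannianBundle (fun x : M => TangentSpace (𝓡∂ n) x)]

/-- The inward pointing unit normal vector `ν` at `p ∈ ∂M`: the normalised gradient of the
coordinate that vanishes on `∂M` and is positive inside `M`. -/
def inwardNormal (p : M) : TangentSpace (𝓡∂ n) p :=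
  haveI : CompleteSpace (TangentSpace (𝓡∂ n) p) := FiniteDimensional.complete ℝ _
  let grad := (InnerProductSpace.toDual ℝ (TangentSpace (𝓡∂ n) p)).symm (boundaryDifferential n p p)
  ‖grad‖⁻¹ • grad

variable [IsManifold (𝓡∂ n) ∞ M]
  [IsContMDiffRiemannianBundle (𝓡∂ n) ∞ (EuclideanSpace ℝ (Fin n))
    (fun x : M => TangentSpace (𝓡∂ n) x)]

/-- `ν` has norm one, is orthogonal to `T_p ∂M`, and points inward. -/
theorem inwardNormal_spec (p : M) :
    ‖inwardNormal n p‖ = 1 ∧ (∀ y ∈ boundaryTangent n p, inner ℝ (inwardNormal n p) y = 0) ∧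
      0 < boundaryDifferential n p p (inwardNormal n p) := by
  have : CompleteSpace (TangentSpace (𝓡∂ n) p) := FiniteDimensional.complete ℝ _
  set grad := (InnerProductSpace.toDual ℝ (TangentSpace (𝓡∂ n) p)).symm
    (boundaryDifferential n p p) with hg
  have hν : inwardNormal n p = ‖grad‖⁻¹ • grad := rfl
  have hin : ∀ y, inner ℝ grad y = boundaryDifferential n p p y := by
    intro y; simp [hg]
  have h0 : grad ≠ 0 := by
    intro h
    obtain ⟨v, hv⟩ : ∃ v, chartDifferential n p p v = EuclideanSpace.single 0 1 := by
      obtain ⟨A, hA⟩ :=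
        isInvertible_chartDifferential n (mem_chart_source (EuclideanHalfSpace n) p)
      exact ⟨A.symm (EuclideanSpace.single 0 1), by simp [← hA]⟩
    have := hin v
    simp [h, boundaryDifferential, hv] at this
  have hpos : 0 < ‖grad‖ := norm_pos_iff.2 h0
  refine ⟨?_, ?_, ?_⟩
  · rw [hν, norm_smul, norm_inv, norm_norm, inv_mul_cancel₀ hpos.ne']
  · intro y hy
    rw [hν, inner_smul_left, hin]
    have : boundaryDifferential n p p y = 0 := hy
    simp [this]
  · rw [hν, map_smul, ← hin, real_inner_self_eq_norm_sq, smul_eq_mul]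
    positivity

/-- The second fundamental form of `∂M` at `p`: `B(x, y) = (∇_x Y)^N`, the component of `∇_x Y`
normal to `∂M`, where `Y` is a local extension of `y`. Every other extension of `y` tangent to `∂M`
gives the same value, see `secondFundamentalForm_eq`. -/
def secondFundamentalForm (p : M) :
    boundaryTangent n p →ₗ[ℝ] boundaryTangent n p →ₗ[ℝ] TangentSpace (𝓡∂ n) p :=
  LinearMap.mk₂ ℝ
    (fun x y => (boundaryTangent n p)ᗮ.starProjection
      (leviCivita (𝓡∂ n) M (localExtension (y : TangentSpace (𝓡∂ n) p)) p
        (x : TangentSpace (𝓡∂ n) p)))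
    (fun x x' y => by simp only [Submodule.coe_add, map_add])
    (fun c x y => by simp only [Submodule.coe_smul, map_smul])
    (fun x y y' => by
      have := (leviCivita (𝓡∂ n) M).isCovariantDerivativeOnUniv.add
        (mdifferentiableAt_localExtension (y : TangentSpace (𝓡∂ n) p))
        (mdifferentiableAt_localExtension (y' : TangentSpace (𝓡∂ n) p))
      simp only [Submodule.coe_add, localExtension_add, this, add_apply, map_add])
    (fun c x y => by
      have := (leviCivita (𝓡∂ n) M).isCovariantDerivativeOnUniv.smul_const c
        (mdifferentiableAt_localExtension (y : TangentSpace (𝓡∂ n) p))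
      simp [localExtension_smul, this])

/-- The shape operator `S_η` of `∂M` at `p`: `⟨S_η x, y⟩ = ⟨B(x, y), η⟩`. -/
def shapeOperator (p : M) (η : TangentSpace (𝓡∂ n) p) :
    boundaryTangent n p →ₗ[ℝ] boundaryTangent n p :=
  haveI : CompleteSpace (boundaryTangent n p) := FiniteDimensional.complete ℝ _
  { toFun := fun x => (InnerProductSpace.toDual ℝ (boundaryTangent n p)).symm
      ((innerSL ℝ η).comp (LinearMap.toContinuousLinearMap (secondFundamentalForm n p x)))
    map_add' := fun x x' => by simp
    map_smul' := fun c x => by simp }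

theorem inner_shapeOperator (p : M) (η : TangentSpace (𝓡∂ n) p) (x y : boundaryTangent n p) :
    inner ℝ (shapeOperator n p η x : TangentSpace (𝓡∂ n) p) (y : TangentSpace (𝓡∂ n) p) =
      inner ℝ (secondFundamentalForm n p x y) η := by
  have : CompleteSpace (boundaryTangent n p) := FiniteDimensional.complete ℝ _
  rw [← Submodule.coe_inner, real_inner_comm η]
  simp [shapeOperator]

/-- The mean curvature of `∂M ⊆ M` at `p` with respect to the outward pointing unit normal `-ν`:
the trace of the shape operator `S_{-ν}` divided by the dimension of `∂M`. -/
def meanCurvature (p : M) : ℝ :=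
  1 / (Module.finrank ℝ (boundaryTangent n p) : ℝ) *
    LinearMap.trace ℝ (boundaryTangent n p) (shapeOperator n p (-inwardNormal n p))

end Boundary

section WellDefined

variable {n : ℕ} [NeZero n]
  {M : Type*} [TopologicalSpace M] [ChartedSpace (EuclideanHalfSpace n) M] [IsManifold (𝓡∂ n) ∞ M]

theorem mem_boundary_iff {p q : M} (hq : q ∈ (chartAt (EuclideanHalfSpace n) p).source) :
    q ∈ (𝓡∂ n).boundary M ↔ extChartAt (𝓡∂ n) p q 0 = 0 := by
  have hr : extChartAt (𝓡∂ n) p q ∈ range (𝓡∂ n) :=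
    extChartAt_target_subset_range p ((extChartAt (𝓡∂ n) p).map_source (by simpa using hq))
  have hq' : extChartAt (𝓡∂ n) p q ∈ interior (range (𝓡∂ n)) ↔
      q ∈ (𝓡∂ n).interior M := by
    rw [ModelWithCorners.interior, mem_ofPred_eq,
      ModelWithCorners.isInteriorPoint_iff_of_mem_atlas (I := 𝓡∂ n) (n := ∞) (by simp)
      (chart_mem_atlas (EuclideanHalfSpace n) p) hq]
    constructor
    · intro h
      exact (OpenPartialHomeomorph.mem_interior_extend_target _
        ((chartAt (EuclideanHalfSpace n) p).map_source hq) h)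
    · intro h
      exact interior_mono (extChartAt_target_subset_range p) h
  rw [interior_range_modelWithCornersEuclideanHalfSpace] at hq'
  rw [range_modelWithCornersEuclideanHalfSpace] at hr
  rw [← ModelWithCorners.compl_interior, mem_compl_iff, ← hq']
  simp only [mem_ofPred_eq, not_lt] at hr ⊢
  exact ⟨fun h => le_antisymm h hr, fun h => h.le⟩

theorem derivative_eq_zero_of_tangent {p q : M}
    (hq : q ∈ (chartAt (EuclideanHalfSpace n) p).source) (hqb : q ∈ (𝓡∂ n).boundary M)
    {g : M → ℝ} (hg : MDifferentiableAt (𝓡∂ n) 𝓘(ℝ, ℝ) g q) (hg0 : ∀ᶠ r in 𝓝 q, r ∈ (𝓡∂ n).boundary M → g r = 0)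
    {v : TangentSpace (𝓡∂ n) q} (hv : boundaryDifferential n p q v = 0) :
    mvfderiv (𝓡∂ n) g q v = 0 := by
  set φ := extChartAt (𝓡∂ n) p with hφ
  have hqs : q ∈ φ.source := by simpa [hφ] using hq
  have hzt : φ q ∈ φ.target := φ.map_source hqs
  have hinv : φ.symm (φ q) = q := φ.left_inv hqs
  have hA := (mdifferentiableWithinAt_extChartAt_symm (I := 𝓡∂ n) hzt).hasMFDerivWithinAt
  have hg' : HasMFDerivAt (𝓡∂ n) 𝓘(ℝ, ℝ) g (φ.symm (φ q)) (mfderiv (𝓡∂ n) 𝓘(ℝ, ℝ) g (φ.symm (φ q))) := by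
    rw [hinv]; exact hg.hasMFDerivAt
  have hc := (hg'.comp_hasMFDerivWithinAt (φ q) hA).hasFDerivWithinAt
  set S : Set (EuclideanSpace ℝ (Fin n)) := {y | y 0 = 0}
  have hS : S ⊆ range (𝓡∂ n) := by
    rw [range_modelWithCornersEuclideanHalfSpace]
    exact fun y hy => (show y 0 = 0 from hy).ge
  have hc := hc.mono hS
  have hzS : φ q ∈ S := (mem_boundary_iff hq).1 hqb
  have hmin : IsLocalMinOn (g ∘ φ.symm) S (φ q) := by
    have hcont : Filter.Tendsto φ.symm (𝓝[S] (φ q)) (𝓝 q) := by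
      have h := (continuousAt_extChartAt_symm'' (I := 𝓡∂ n) hzt).tendsto
      rw [hinv] at h
      exact h.mono_left nhdsWithin_le_nhds
    have h1 : ∀ᶠ y in 𝓝[S] (φ q), y ∈ φ.target :=
      nhdsWithin_mono _ hS (extChartAt_target_mem_nhdsWithin' hqs)
    filter_upwards [hcont.eventually hg0, h1, self_mem_nhdsWithin] with y hy hyt hyS
    have h0 : g (φ.symm (φ q)) = 0 := by rw [hinv]; exact hg0.self_of_nhds hqb
    have : g (φ.symm y) = 0 := by
      apply hy
      rw [mem_boundary_iff (p := p)]
      · rw [φ.right_inv hyt]; exact hyS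
      · have := φ.map_target hyt
        simpa [hφ] using this
    simp [h0, this]
  have hw : ∀ w : EuclideanSpace ℝ (Fin n), w 0 = 0 → w ∈ posTangentConeAt S (φ q) := by
    intro w hw
    apply mem_posTangentConeAt_of_segment_subset
    intro y hy
    obtain ⟨a, b, -, -, -, rfl⟩ := hy
    have hz : φ q 0 = 0 := hzS
    simp [S, hw, hz]
  have hv' : (chartDifferential n p q v) 0 = 0 := hv
  have hfin := hmin.hasFDerivWithinAt_eq_zero hc (hw _ hv') (hw _ (by simp [hv']))
  have hid : mfderivWithin 𝓘(ℝ, EuclideanSpace ℝ (Fin n)) (𝓡∂ n) φ.symm (range (𝓡∂ n)) (φ q)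
      (chartDifferential n p q v) = v :=
    congrArg (fun L : TangentSpace (𝓡∂ n) q →L[ℝ] TangentSpace (𝓡∂ n) q => L v)
      (mfderivWithin_extChartAt_symm_comp_mfderiv_extChartAt' (I := 𝓡∂ n) hqs)
  have hgq : (mfderiv (𝓡∂ n) 𝓘(ℝ, ℝ) g (φ.symm (φ q)) : EuclideanSpace ℝ (Fin n) →L[ℝ] ℝ) =
      mfderiv (𝓡∂ n) 𝓘(ℝ, ℝ) g q :=
    (show ∀ r, r = q → (mfderiv (𝓡∂ n) 𝓘(ℝ, ℝ) g r : EuclideanSpace ℝ (Fin n) →L[ℝ] ℝ) =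
      mfderiv (𝓡∂ n) 𝓘(ℝ, ℝ) g q by rintro r rfl; rfl) _ hinv
  have h2 : (mfderiv (𝓡∂ n) 𝓘(ℝ, ℝ) g (φ.symm (φ q)) : EuclideanSpace ℝ (Fin n) →L[ℝ] ℝ)
      (mfderivWithin 𝓘(ℝ, EuclideanSpace ℝ (Fin n)) (𝓡∂ n) φ.symm (range (𝓡∂ n)) (φ q)
        (chartDifferential n p q v)) = 0 := hfin
  rw [hgq, hid] at h2
  exact h2

theorem boundaryDifferential_eq_zero {p p' q : M}
    (hq : q ∈ (chartAt (EuclideanHalfSpace n) p).source)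
    (hq' : q ∈ (chartAt (EuclideanHalfSpace n) p').source) (hqb : q ∈ (𝓡∂ n).boundary M)
    {v : TangentSpace (𝓡∂ n) q} (hv : boundaryDifferential n p q v = 0) :
    boundaryDifferential n p' q v = 0 := by
  have h1 : HasMFDerivAt (𝓡∂ n) 𝓘(ℝ, EuclideanSpace ℝ (Fin n)) (extChartAt (𝓡∂ n) p') q
      (chartDifferential n p' q) := (mdifferentiableAt_extChartAt hq').hasMFDerivAt
  have h2 : HasMFDerivAt (𝓡∂ n) 𝓘(ℝ, ℝ) (fun r => extChartAt (𝓡∂ n) p' r 0) q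
      (boundaryDifferential n p' q) :=
    ((EuclideanSpace.proj (0 : Fin n) : EuclideanSpace ℝ (Fin n) →L[ℝ] ℝ).hasMFDerivAt).comp q h1
  have h3 := derivative_eq_zero_of_tangent hq hqb h2.mdifferentiableAt ?_ hv
  · have h4 : mfderiv (𝓡∂ n) 𝓘(ℝ, ℝ) (fun r => extChartAt (𝓡∂ n) p' r 0) q v = 0 := h3
    rw [h2.mfderiv] at h4
    exact h4
  · filter_upwards [(chartAt (EuclideanHalfSpace n) p').open_source.mem_nhds hq'] with r hr hrb
    exact (mem_boundary_iff hr).1 hrb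

/-- The local extension of a vector tangent to `∂M` is tangent to `∂M` along `∂M`. -/
theorem localExtension_mem_boundaryTangent {p q : M} {y : TangentSpace (𝓡∂ n) p}
    (hy : y ∈ boundaryTangent n p)
    (hq : q ∈ (chartAt (EuclideanHalfSpace n) p).source) (hqb : q ∈ (𝓡∂ n).boundary M) :
    localExtension y q ∈ boundaryTangent n q := by
  refine boundaryDifferential_eq_zero (p := p) hq (mem_chart_source _ q) hqb ?_
  have hy' : boundaryDifferential n p p y = 0 := hy
  rwa [boundaryDifferential, ContinuousLinearMap.comp_apply,
    chartDifferential_localExtension y hq]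

theorem mdifferentiableAt_component {p : M} {W : Π q : M, TangentSpace (𝓡∂ n) q}
    (hW : MDifferentiableAt (𝓡∂ n) ((𝓡∂ n).prod 𝓘(ℝ, EuclideanSpace ℝ (Fin n)))
      (fun q => (⟨q, W q⟩ : TangentBundle (𝓡∂ n) M)) p) (i : Fin n) :
    MDifferentiableAt (𝓡∂ n) 𝓘(ℝ, ℝ) (fun q => chartDifferential n p q (W q) i) p := by
  have h := (mdifferentiableAt_section (𝓡∂ n) W).1 hW
  have h' : MDifferentiableAt (𝓡∂ n) 𝓘(ℝ, EuclideanSpace ℝ (Fin n))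
      (fun q => chartDifferential n p q (W q)) p := by
    refine h.congr_of_eventuallyEq ?_
    filter_upwards [chart_source_mem_nhds (EuclideanHalfSpace n) p] with q hq
    exact (trivializationAt_apply_snd hq _).symm
  exact ((EuclideanSpace.proj i : EuclideanSpace ℝ (Fin n) →L[ℝ] ℝ).hasMFDerivAt
    ).mdifferentiableAt.comp p h'

variable [RiemannianBundle (fun x : M => TangentSpace (𝓡∂ n) x)]
  [IsContMDiffRiemannianBundle (𝓡∂ n) ∞ (EuclideanSpace ℝ (Fin n))
    (fun x : M => TangentSpace (𝓡∂ n) x)]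

/-- The second fundamental form does not depend on the local extension: it is the normal component
of `∇_x Y` for every differentiable extension `Y` of `y` that is tangent to `∂M` along `∂M`. -/
theorem secondFundamentalForm_eq {p : M} (hp : p ∈ (𝓡∂ n).boundary M)
    (x y : boundaryTangent n p) {Y : Π q : M, TangentSpace (𝓡∂ n) q}
    (hY : MDifferentiableAt (𝓡∂ n) ((𝓡∂ n).prod 𝓘(ℝ, EuclideanSpace ℝ (Fin n)))
      (fun q => (⟨q, Y q⟩ : TangentBundle (𝓡∂ n) M)) p)
    (hYp : Y p = y)
    (hYt : ∀ᶠ q in 𝓝 p, q ∈ (𝓡∂ n).boundary M → Y q ∈ boundaryTangent n q) :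
    secondFundamentalForm n p x y =
      (boundaryTangent n p)ᗮ.starProjection
        (leviCivita (𝓡∂ n) M Y p (x : TangentSpace (𝓡∂ n) p)) := by
  set cov := leviCivita (𝓡∂ n) M
  have hcov := cov.isCovariantDerivativeOnUniv
  let F : Fin n → Π q : M, TangentSpace (𝓡∂ n) q := fun i =>
    localExtension (p := p) (EuclideanSpace.single i 1 : EuclideanSpace ℝ (Fin n))
  let w : Fin n → M → ℝ := fun i q =>
    chartDifferential n p q (Y q) i - chartDifferential n p p (y : TangentSpace (𝓡∂ n) p) i
  have hF : ∀ i, MDifferentiableAt (𝓡∂ n) ((𝓡∂ n).prod 𝓘(ℝ, EuclideanSpace ℝ (Fin n)))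
      (fun q => (⟨q, F i q⟩ : TangentBundle (𝓡∂ n) M)) p :=
    fun i => mdifferentiableAt_localExtension _
  have hw : ∀ i, MDifferentiableAt (𝓡∂ n) 𝓘(ℝ, ℝ) (w i) p :=
    fun i => (mdifferentiableAt_component hY i).sub mdifferentiableAt_const
  have hwF : ∀ i, MDifferentiableAt (𝓡∂ n) ((𝓡∂ n).prod 𝓘(ℝ, EuclideanSpace ℝ (Fin n)))
      (fun q => (⟨q, (w i • F i) q⟩ : TangentBundle (𝓡∂ n) M)) p :=
    fun i => (hw i).smul_section (hF i)
  have hsum : ∀ s : Finset (Fin n),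
      MDifferentiableAt (𝓡∂ n) ((𝓡∂ n).prod 𝓘(ℝ, EuclideanSpace ℝ (Fin n)))
        (fun q => (⟨q, (∑ i ∈ s, w i • F i) q⟩ : TangentBundle (𝓡∂ n) M)) p ∧
      cov (∑ i ∈ s, w i • F i) p = ∑ i ∈ s, cov (w i • F i) p := by
    intro s
    induction s using Finset.induction_on with
    | empty =>
      simp only [Finset.sum_empty]
      exact ⟨mdifferentiableAt_zeroSection .., hcov.zero⟩
    | insert a s ha ih =>
      rw [Finset.sum_insert ha, Finset.sum_insert ha, ← ih.2]
      exact ⟨mdifferentiableAt_add_section (hwF a) ih.1, hcov.add (hwF a) ih.1⟩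
  have hY0 := mdifferentiableAt_localExtension (y : TangentSpace (𝓡∂ n) p)
  have hYeq : ∀ᶠ q in 𝓝 p, Y q =
      (localExtension (y : TangentSpace (𝓡∂ n) p) + ∑ i, w i • F i) q := by
    filter_upwards [chart_source_mem_nhds (EuclideanHalfSpace n) p] with q hq
    obtain ⟨A, hA⟩ := isInvertible_chartDifferential n hq
    have hinj : Function.Injective (chartDifferential n p q) := by
      rw [← hA]; exact A.injective
    apply hinj
    ext j
    have hFq : ∀ i, chartDifferential n p q (F i q) = EuclideanSpace.single i (1 : ℝ) := by
      intro i
      have h := chartDifferential_localExtension (p := p)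
        (EuclideanSpace.single i 1 : EuclideanSpace ℝ (Fin n)) hq
      rw [chartDifferential_self] at h
      exact h
    simp [hFq, chartDifferential_localExtension _ hq, w, Finset.sum_apply, Pi.single_apply]
  have hcovY : cov Y p = cov (localExtension (y : TangentSpace (𝓡∂ n) p)) p +
      ∑ i, (mvfderiv (𝓡∂ n) (w i) p).smulRight (F i p) := by
    rw [hcov.congr_of_eventuallyEq hY (mdifferentiableAt_add_section hY0 (hsum _).1)
      Filter.univ_mem hYeq, hcov.add hY0 (hsum _).1, (hsum _).2]
    congr 1
    refine Finset.sum_congr rfl fun i _ => ?_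
    rw [hcov.leibniz (hF i) (hw i)]
    simp [w, hYp]
  have hyT : boundaryDifferential n p p y = 0 := y.2
  have hw0 : mvfderiv (𝓡∂ n) (w 0) p (x : TangentSpace (𝓡∂ n) p) = 0 := by
    refine derivative_eq_zero_of_tangent (mem_chart_source _ p) hp (hw 0) ?_ x.2
    filter_upwards [hYt, chart_source_mem_nhds (EuclideanHalfSpace n) p] with q hqt hq hqb
    have h1 : boundaryDifferential n p q (Y q) = 0 :=
      boundaryDifferential_eq_zero (mem_chart_source _ q) hq hqb (hqt hqb)
    have h2 : w 0 q = boundaryDifferential n p q (Y q) - boundaryDifferential n p p y := rfl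
    rw [h2, h1, hyT, sub_zero]
  have hproj : ∀ i, (boundaryTangent n p)ᗮ.starProjection
      (mvfderiv (𝓡∂ n) (w i) p (x : TangentSpace (𝓡∂ n) p) • F i p) = 0 := by
    intro i
    by_cases hi : i = 0
    · rw [hi, hw0, zero_smul, map_zero]
    · have hmem : F i p ∈ boundaryTangent n p := by
        have h1 : F i p = (EuclideanSpace.single i 1 : EuclideanSpace ℝ (Fin n)) :=
          localExtension_self _
        have h2 : boundaryDifferential n p p (F i p) = 0 := by
          rw [h1, boundaryDifferential, chartDifferential_self]
          have : (EuclideanSpace.single i (1 : ℝ) : EuclideanSpace ℝ (Fin n)) 0 = 0 := by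
            simp [Ne.symm hi]
          exact this
        exact h2
      rw [map_smul, (Submodule.starProjection_apply_eq_zero_iff _).2, smul_zero]
      rwa [Submodule.orthogonal_orthogonal]
  rw [hcovY]
  simp only [add_apply, sum_apply, map_add, map_sum,
    ContinuousLinearMap.smulRight_apply, hproj, Finset.sum_const_zero, add_zero]
  rfl

end WellDefined

section TypeA

variable {n : ℕ} [NeZero n]
  {M : Type*} [TopologicalSpace M] [ChartedSpace (EuclideanHalfSpace n) M]

/-- The coordinate vector field `∂/∂x_i` of a chart `e` with coordinates `x = (x_0, …, x_{n-1})`: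
the field on the domain of `e` with `dx (∂/∂x_i) = e_i`. The coordinate that vanishes on `∂M` and
is positive inside `M` is the one with index `0`. -/
def coordField (e : OpenPartialHomeomorph M (EuclideanHalfSpace n)) (i : Fin n) (q : M) :
    TangentSpace (𝓡∂ n) q :=
  VectorField.mpullback (𝓡∂ n) 𝓘(ℝ, EuclideanSpace ℝ (Fin n)) (e.extend (𝓡∂ n))
    (fun _ => (EuclideanSpace.single i 1 : EuclideanSpace ℝ (Fin n))) q

/-- The coordinate derivative `∂f/∂x_i`, one-sided in the normal direction on `∂M`. -/
def coordDeriv (e : OpenPartialHomeomorph M (EuclideanHalfSpace n)) (i : Fin n) (f : M → ℝ)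
    (q : M) : ℝ :=
  fderivWithin ℝ (f ∘ (e.extend (𝓡∂ n)).symm) (range (𝓡∂ n)) (e.extend (𝓡∂ n) q)
    (EuclideanSpace.single i 1)

variable [RiemannianBundle (fun x : M => TangentSpace (𝓡∂ n) x)]

/-- The metric tensor `g_ij = ⟨∂/∂x_i, ∂/∂x_j⟩` in the coordinates of `e`. -/
def metricTensor (e : OpenPartialHomeomorph M (EuclideanHalfSpace n)) (q : M) :
    Matrix (Fin n) (Fin n) ℝ :=
  Matrix.of fun i j => inner ℝ (coordField e i q) (coordField e j q)

/-- `a = √det(g_ij)`. -/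
def volumeDensity (e : OpenPartialHomeomorph M (EuclideanHalfSpace n)) (q : M) : ℝ :=
  √(metricTensor e q).det

/-- `τ = (∂a/∂x_0) / a`, where `x_0` is the coordinate normal to the boundary. -/
def tau (e : OpenPartialHomeomorph M (EuclideanHalfSpace n)) (q : M) : ℝ :=
  coordDeriv e 0 (volumeDensity e) q / volumeDensity e q

/-- Type A boundary coordinates: a smooth chart of the manifold with boundary such that
`∂/∂x_0` has norm one everywhere and, on the boundary, is orthogonal to the other coordinate
fields and is the inward pointing unit normal. -/
structure IsTypeA (e : OpenPartialHomeomorph M (EuclideanHalfSpace n)) : Prop where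
  mem_maximalAtlas : e ∈ IsManifold.maximalAtlas (𝓡∂ n) ∞ M
  orthogonal : ∀ q ∈ e.source ∩ (𝓡∂ n).boundary M, ∀ i : Fin n, i ≠ 0 →
    inner ℝ (coordField e 0 q) (coordField e i q) = 0
  norm_eq_one : ∀ q ∈ e.source, ‖coordField e 0 q‖ = 1
  inward : ∀ q ∈ e.source ∩ (𝓡∂ n).boundary M, coordField e 0 q = inwardNormal n q

end TypeA

end RiemannianBoundary

end

noncomputable section

namespace RiemannianBoundary

section CoordinateFields

variable {n : ℕ} [NeZero n]
  {M : Type*} [TopologicalSpace M] [ChartedSpace (EuclideanHalfSpace n) M]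

/-- The differential at `q` of the coordinate map of the chart `e`. -/
def extendDifferential (e : OpenPartialHomeomorph M (EuclideanHalfSpace n)) (q : M) :
    TangentSpace (𝓡∂ n) q →L[ℝ] EuclideanSpace ℝ (Fin n) :=
  mfderiv (𝓡∂ n) 𝓘(ℝ, EuclideanSpace ℝ (Fin n)) (e.extend (𝓡∂ n)) q

/-- The differential at the coordinates of `q` of the inverse of the coordinate map of `e`. -/
def extendSymmDifferential (e : OpenPartialHomeomorph M (EuclideanHalfSpace n)) (q : M) :
    EuclideanSpace ℝ (Fin n) →L[ℝ] TangentSpace (𝓡∂ n) q :=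
  mfderivWithin 𝓘(ℝ, EuclideanSpace ℝ (Fin n)) (𝓡∂ n) (e.extend (𝓡∂ n)).symm
    (range (𝓡∂ n)) (e.extend (𝓡∂ n) q)

variable [IsManifold (𝓡∂ n) ∞ M]
  {e : OpenPartialHomeomorph M (EuclideanHalfSpace n)} {q : M}

theorem hasMFDerivAt_extend (he : e ∈ IsManifold.maximalAtlas (𝓡∂ n) ∞ M)
    (hq : q ∈ e.source) :
    HasMFDerivAt (𝓡∂ n) 𝓘(ℝ, EuclideanSpace ℝ (Fin n)) (e.extend (𝓡∂ n)) q
      (extendDifferential e q) :=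
  ((e.contMDiffAt_extend he hq).mdifferentiableAt (by simp)).hasMFDerivAt

theorem hasMFDerivWithinAt_extend_symm (he : e ∈ IsManifold.maximalAtlas (𝓡∂ n) ∞ M)
    (hq : q ∈ e.source) :
    HasMFDerivWithinAt 𝓘(ℝ, EuclideanSpace ℝ (Fin n)) (𝓡∂ n) (e.extend (𝓡∂ n)).symm
      (range (𝓡∂ n)) (e.extend (𝓡∂ n) q) (extendSymmDifferential e q) := by
  have h := contMDiffOn_extend_symm he (e.extend (𝓡∂ n) q) ⟨e q, e.map_source hq, rfl⟩
  have h' : MDifferentiableWithinAt 𝓘(ℝ, EuclideanSpace ℝ (Fin n)) (𝓡∂ n)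
      (e.extend (𝓡∂ n)).symm (range (𝓡∂ n)) (e.extend (𝓡∂ n) q) := by
    refine (h.mdifferentiableWithinAt (by simp)).mono_of_mem_nhdsWithin ?_
    have := e.extend_target_mem_nhdsWithin (I := 𝓡∂ n) hq
    rw [e.extend_target'] at this
    exact this
  exact h'.hasMFDerivWithinAt

theorem extend_symm_extend (hq : q ∈ e.source) :
    (e.extend (𝓡∂ n)).symm (e.extend (𝓡∂ n) q) = q :=
  (e.extend (𝓡∂ n)).left_inv (by rwa [e.extend_source])

theorem extendSymmDifferential_extendDifferential
    (he : e ∈ IsManifold.maximalAtlas (𝓡∂ n) ∞ M) (hq : q ∈ e.source)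
    (v : TangentSpace (𝓡∂ n) q) :
    extendSymmDifferential e q (extendDifferential e q v) = v := by
  have h1 := hasMFDerivAt_extend he hq
  have h2 := hasMFDerivWithinAt_extend_symm he hq
  have h3 : HasMFDerivWithinAt (𝓡∂ n) (𝓡∂ n)
      ((e.extend (𝓡∂ n)).symm ∘ e.extend (𝓡∂ n)) univ q
      ((extendSymmDifferential e q).comp (extendDifferential e q)) :=
    h2.comp q h1.hasMFDerivWithinAt (fun y _ => ⟨e y, rfl⟩)
  have h4 : HasMFDerivAt (𝓡∂ n) (𝓡∂ n)
      ((e.extend (𝓡∂ n)).symm ∘ e.extend (𝓡∂ n)) q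
      (ContinuousLinearMap.id ℝ (TangentSpace (𝓡∂ n) q)) := by
    refine (hasMFDerivAt_id q).congr_of_eventuallyEq ?_
    filter_upwards [e.open_source.mem_nhds hq] with y hy
    exact extend_symm_extend hy
  have h5 := hasMFDerivAt_unique (hasMFDerivWithinAt_univ.1 h3) h4
  exact congrArg (fun L : TangentSpace (𝓡∂ n) q →L[ℝ] TangentSpace (𝓡∂ n) q => L v) h5

theorem extendDifferential_extendSymmDifferential
    (he : e ∈ IsManifold.maximalAtlas (𝓡∂ n) ∞ M) (hq : q ∈ e.source)
    (v : EuclideanSpace ℝ (Fin n)) :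
    extendDifferential e q (extendSymmDifferential e q v) = v := by
  have h1 := hasMFDerivAt_extend he hq
  have h2 := hasMFDerivWithinAt_extend_symm he hq
  have h1' : HasMFDerivAt (𝓡∂ n) 𝓘(ℝ, EuclideanSpace ℝ (Fin n)) (e.extend (𝓡∂ n))
      ((e.extend (𝓡∂ n)).symm (e.extend (𝓡∂ n) q)) (extendDifferential e q) := by
    rw [extend_symm_extend hq]; exact h1
  have h3 : HasFDerivWithinAt (e.extend (𝓡∂ n) ∘ (e.extend (𝓡∂ n)).symm)
      ((extendDifferential e q).comp (extendSymmDifferential e q))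
      (range (𝓡∂ n)) (e.extend (𝓡∂ n) q) :=
    (h1'.comp_hasMFDerivWithinAt (e.extend (𝓡∂ n) q) h2).hasFDerivWithinAt
  have h4 : HasFDerivWithinAt (e.extend (𝓡∂ n) ∘ (e.extend (𝓡∂ n)).symm)
      (ContinuousLinearMap.id ℝ _) (range (𝓡∂ n)) (e.extend (𝓡∂ n) q) := by
    refine (hasFDerivWithinAt_id (𝕜 := ℝ) _ _).congr_of_eventuallyEq ?_ ?_
    · filter_upwards [e.extend_target_mem_nhdsWithin (I := 𝓡∂ n) hq] with y hy
      exact (e.extend (𝓡∂ n)).right_inv hy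
    · exact (e.extend (𝓡∂ n)).right_inv
        ((e.extend (𝓡∂ n)).map_source (by rwa [e.extend_source]))
  have h5 := ((𝓡∂ n).uniqueDiffOn _ ⟨e q, rfl⟩).eq h3 h4
  exact congrArg (fun L : EuclideanSpace ℝ (Fin n) →L[ℝ] EuclideanSpace ℝ (Fin n) => L v) h5

/-- The differential of a chart as a continuous linear equivalence. -/
def extendDifferentialEquiv (he : e ∈ IsManifold.maximalAtlas (𝓡∂ n) ∞ M) (hq : q ∈ e.source) :
    TangentSpace (𝓡∂ n) q ≃L[ℝ] EuclideanSpace ℝ (Fin n) :=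
  ContinuousLinearEquiv.equivOfInverse (extendDifferential e q) (extendSymmDifferential e q)
    (extendSymmDifferential_extendDifferential he hq)
    (extendDifferential_extendSymmDifferential he hq)

theorem coordField_eq (he : e ∈ IsManifold.maximalAtlas (𝓡∂ n) ∞ M) (hq : q ∈ e.source)
    (i : Fin n) :
    coordField e i q = extendSymmDifferential e q (EuclideanSpace.single i 1) := by
  change (extendDifferential e q).inverse (EuclideanSpace.single i 1) = _
  have h : extendDifferential e q = extendDifferentialEquiv he hq := rfl
  rw [h, ContinuousLinearMap.inverse_equiv]
  rfl

theorem linearIndependent_coordField (he : e ∈ IsManifold.maximalAtlas (𝓡∂ n) ∞ M)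
    (hq : q ∈ e.source) : LinearIndependent ℝ (fun i => coordField e i q) := by
  have h : (fun i => coordField e i q) =
      (extendDifferentialEquiv he hq).symm ∘ EuclideanSpace.basisFun (Fin n) ℝ := by
    ext1 i
    simpa using! coordField_eq he hq i
  rw [h]
  exact (EuclideanSpace.basisFun (Fin n) ℝ).orthonormal.linearIndependent.map'
    (extendDifferentialEquiv he hq).symm.toLinearEquiv.toLinearMap (LinearEquiv.ker _)

/-- The constant vector field on Euclidean space. -/
def constField (v : EuclideanSpace ℝ (Fin n)) :
    Π y : EuclideanSpace ℝ (Fin n), TangentSpace 𝓘(ℝ, EuclideanSpace ℝ (Fin n)) y :=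
  fun _ => v

theorem mdifferentiableAt_constField (v z : EuclideanSpace ℝ (Fin n)) :
    MDifferentiableAt 𝓘(ℝ, EuclideanSpace ℝ (Fin n))
      (𝓘(ℝ, EuclideanSpace ℝ (Fin n)).prod 𝓘(ℝ, EuclideanSpace ℝ (Fin n)))
      (fun y => (⟨y, constField v y⟩ : TangentBundle 𝓘(ℝ, EuclideanSpace ℝ (Fin n))
        (EuclideanSpace ℝ (Fin n)))) z := by
  refine (mdifferentiableAt_section _ (constField v)).2 ?_
  simpa [constField] using! mdifferentiableAt_const

theorem mlieBracket_constField (v w z : EuclideanSpace ℝ (Fin n)) :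
    VectorField.mlieBracket 𝓘(ℝ, EuclideanSpace ℝ (Fin n)) (constField v) (constField w) z = 0 := by
  rw [← VectorField.mlieBracketWithin_univ, VectorField.mlieBracketWithin_eq_lieBracketWithin]
  change fderivWithin ℝ (fun _ : EuclideanSpace ℝ (Fin n) => w) univ z v -
    fderivWithin ℝ (fun _ : EuclideanSpace ℝ (Fin n) => v) univ z w = 0
  simp

theorem mdifferentiableAt_coordField (he : e ∈ IsManifold.maximalAtlas (𝓡∂ n) ∞ M)
    (hq : q ∈ e.source) (i : Fin n) :
    MDifferentiableAt (𝓡∂ n) ((𝓡∂ n).prod 𝓘(ℝ, EuclideanSpace ℝ (Fin n)))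
      (fun q => (⟨q, coordField e i q⟩ : TangentBundle (𝓡∂ n) M)) q :=
  MDifferentiableAt.mpullback_vectorField (n := ∞) (mdifferentiableAt_constField _ _)
    (e.contMDiffAt_extend he hq) ⟨extendDifferentialEquiv he hq, rfl⟩
    (by norm_cast)

/-- Coordinate fields commute. -/
theorem mlieBracket_coordField (he : e ∈ IsManifold.maximalAtlas (𝓡∂ n) ∞ M)
    (hq : q ∈ e.source) (i j : Fin n) :
    VectorField.mlieBracket (𝓡∂ n) (coordField e i) (coordField e j) q = 0 := by
  have hsm : minSmoothness ℝ 2 ≤ (∞ : WithTop ℕ∞) := by simp; norm_cast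
  have : IsManifold (𝓡∂ n) (minSmoothness ℝ 2) M := IsManifold.of_le hsm
  have h := VectorField.mpullback_mlieBracket (n := ∞) (I := 𝓡∂ n)
    (mdifferentiableAt_constField (EuclideanSpace.single i 1) (e.extend (𝓡∂ n) q))
    (mdifferentiableAt_constField (EuclideanSpace.single j 1) (e.extend (𝓡∂ n) q))
    (e.contMDiffAt_extend he hq) hsm
  refine h.symm.trans ?_
  exact (congrArg (extendDifferential e q).inverse (mlieBracket_constField _ _ _)).trans (map_zero _)

/-- A differentiable function is differentiable in coordinates, and its coordinate derivative is
its differential applied to the coordinate field. -/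
theorem hasFDerivWithinAt_comp_extend_symm (he : e ∈ IsManifold.maximalAtlas (𝓡∂ n) ∞ M)
    (hq : q ∈ e.source) {f : M → ℝ} (hf : MDifferentiableAt (𝓡∂ n) 𝓘(ℝ, ℝ) f q) :
    HasFDerivWithinAt (f ∘ (e.extend (𝓡∂ n)).symm)
      ((mvfderiv (𝓡∂ n) f q).comp (extendSymmDifferential e q))
      (range (𝓡∂ n)) (e.extend (𝓡∂ n) q) := by
  have h1 : HasMFDerivAt (𝓡∂ n) 𝓘(ℝ, ℝ) f ((e.extend (𝓡∂ n)).symm (e.extend (𝓡∂ n) q))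
      (mfderiv (𝓡∂ n) 𝓘(ℝ, ℝ) f q) := by
    rw [extend_symm_extend hq]; exact hf.hasMFDerivAt
  exact (h1.comp_hasMFDerivWithinAt (e.extend (𝓡∂ n) q)
    (hasMFDerivWithinAt_extend_symm he hq)).hasFDerivWithinAt

theorem coordDeriv_eq (he : e ∈ IsManifold.maximalAtlas (𝓡∂ n) ∞ M)
    (hq : q ∈ e.source) {f : M → ℝ} (hf : MDifferentiableAt (𝓡∂ n) 𝓘(ℝ, ℝ) f q) (i : Fin n) :
    coordDeriv e i f q = mvfderiv (𝓡∂ n) f q (coordField e i q) := by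
  rw [coordDeriv, (hasFDerivWithinAt_comp_extend_symm he hq hf).fderivWithin
    ((𝓡∂ n).uniqueDiffOn _ ⟨e q, rfl⟩), coordField_eq he hq]
  rfl

end CoordinateFields

section TypeACoordinates

variable {n : ℕ} [NeZero n]
  {M : Type*} [TopologicalSpace M] [ChartedSpace (EuclideanHalfSpace n) M] [IsManifold (𝓡∂ n) ∞ M]
  [RiemannianBundle (fun x : M => TangentSpace (𝓡∂ n) x)]
  [IsContMDiffRiemannianBundle (𝓡∂ n) ∞ (EuclideanSpace ℝ (Fin n))
    (fun x : M => TangentSpace (𝓡∂ n) x)]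
  {e : OpenPartialHomeomorph M (EuclideanHalfSpace n)} {p : M}

theorem mem_boundaryTangent_of_inner_inwardNormal {v : TangentSpace (𝓡∂ n) p}
    (hv : inner ℝ (inwardNormal n p) v = 0) : v ∈ boundaryTangent n p := by
  obtain ⟨h1, h2, h3⟩ := inwardNormal_spec n p
  set c := boundaryDifferential n p p v / boundaryDifferential n p p (inwardNormal n p) with hc
  have hw : v - c • inwardNormal n p ∈ boundaryTangent n p := by
    change boundaryDifferential n p p (v - c • inwardNormal n p) = 0
    rw [map_sub, map_smul, smul_eq_mul, hc, div_mul_cancel₀ _ h3.ne', sub_self]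
  have h4 := h2 _ hw
  rw [inner_sub_right, hv, inner_smul_right, real_inner_self_eq_norm_sq, h1] at h4
  have hc0 : c = 0 := by linarith
  change boundaryDifferential n p p v = 0
  rw [hc, div_eq_zero_iff] at hc0
  exact hc0.resolve_right h3.ne'

theorem IsTypeA.coordField_mem_boundaryTangent (he : IsTypeA e)
    (hp : p ∈ e.source ∩ (𝓡∂ n).boundary M) {i : Fin n} (hi : i ≠ 0) :
    coordField e i p ∈ boundaryTangent n p := by
  refine mem_boundaryTangent_of_inner_inwardNormal ?_
  rw [← he.inward p hp]
  exact he.orthogonal p hp i hi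

theorem mdifferentiableAt_metricTensor (he : e ∈ IsManifold.maximalAtlas (𝓡∂ n) ∞ M)
    (hp : p ∈ e.source) (i j : Fin n) :
    MDifferentiableAt (𝓡∂ n) 𝓘(ℝ, ℝ) (fun q => metricTensor e q i j) p :=
  mdifferentiableAt_inner (mdifferentiableAt_coordField he hp i)
    (mdifferentiableAt_coordField he hp j)

theorem det_metricTensor_pos (he : e ∈ IsManifold.maximalAtlas (𝓡∂ n) ∞ M) (hp : p ∈ e.source) :
    0 < (metricTensor e p).det := by
  have h : metricTensor e p = Matrix.gram ℝ (fun i => coordField e i p) := rfl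
  have hl := linearIndependent_coordField he hp
  rw [h]
  exact (Matrix.posDef_gram_of_linearIndependent hl).det_pos

theorem IsTypeA.mvfderiv_metricTensor_eq_zero (he : IsTypeA e)
    (hp : p ∈ e.source ∩ (𝓡∂ n).boundary M) {i j : Fin n} (hi : i ≠ 0) (hj : j ≠ 0) :
    mvfderiv (𝓡∂ n) (fun q => metricTensor e q j 0) p (coordField e i p) = 0 := by
  obtain ⟨hps, hpb⟩ := hp
  refine derivative_eq_zero_of_tangent (mem_chart_source _ p) hpb
    (mdifferentiableAt_metricTensor he.mem_maximalAtlas hps j 0) ?_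
    (he.coordField_mem_boundaryTangent ⟨hps, hpb⟩ hi)
  filter_upwards [e.open_source.mem_nhds hps] with q hq hqb
  exact (real_inner_comm _ _).trans (he.orthogonal q ⟨hq, hqb⟩ j hj)

/-- In Type A coordinates the second fundamental form with respect to `-ν` is half the normal
derivative of the metric tensor. -/
theorem IsTypeA.inner_shapeOperator_coordField (he : IsTypeA e)
    (hp : p ∈ e.source ∩ (𝓡∂ n).boundary M) {i j : Fin n} (hi : i ≠ 0) (hj : j ≠ 0) :
    inner ℝ (shapeOperator n p (-inwardNormal n p)
        ⟨coordField e i p, he.coordField_mem_boundaryTangent hp hi⟩ : TangentSpace (𝓡∂ n) p)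
      (coordField e j p) =
      1 / 2 * mvfderiv (𝓡∂ n) (fun q => metricTensor e q i j) p (coordField e 0 p) := by
  have hA := he.mem_maximalAtlas
  have hd := fun k => mdifferentiableAt_coordField hA hp.1 k
  rw [inner_shapeOperator n p (-inwardNormal n p) ⟨coordField e i p, _⟩
      ⟨coordField e j p, he.coordField_mem_boundaryTangent hp hj⟩,
    secondFundamentalForm_eq hp.2 _ _ (hd j) rfl, Submodule.inner_starProjection_left_eq_right,
    Submodule.starProjection_eq_self_iff.2, inner_neg_right, ← he.inward p hp,
    inner_leviCivita (hd i) (hd j) (hd 0), koszul, mlieBracket_coordField hA hp.1,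
    mlieBracket_coordField hA hp.1, mlieBracket_coordField hA hp.1]
  · have h1 := he.mvfderiv_metricTensor_eq_zero hp hi hj
    have h2 := he.mvfderiv_metricTensor_eq_zero hp hj hi
    simp only [metricTensor, Matrix.of_apply] at h1 h2 ⊢
    rw [h1, h2]
    simp only [inner_zero_left]
    ring
  · refine (Submodule.mem_orthogonal' _ _).2 fun y hy => ?_
    rw [inner_neg_left, (inwardNormal_spec n p).2.1 y hy, neg_zero]
  · filter_upwards [e.open_source.mem_nhds hp.1] with q hq hqb
    exact he.coordField_mem_boundaryTangent ⟨hq, hqb⟩ hj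

/-- The normal derivative of `g_00` vanishes, as `∂/∂x_0` has norm one. -/
theorem IsTypeA.mvfderiv_metricTensor_zero_zero (he : IsTypeA e) (hp : p ∈ e.source) :
    mvfderiv (𝓡∂ n) (fun q => metricTensor e q 0 0) p = 0 := by
  have h : (fun q => metricTensor e q 0 0) =ᶠ[𝓝 p] fun _ => (1 : ℝ) := by
    filter_upwards [e.open_source.mem_nhds hp] with q hq
    simp [metricTensor, he.norm_eq_one q hq]
  have h1 : HasMFDerivAt (𝓡∂ n) 𝓘(ℝ, ℝ) (fun q => metricTensor e q 0 0) p 0 :=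
    (hasMFDerivAt_const (1 : ℝ) p).congr_of_eventuallyEq h
  rw [mvfderiv, h1.mfderiv]
  rfl

end TypeACoordinates

/-- The trace of an endomorphism of an inner product space of dimension two, in terms of the
values `⟨S b_i, b_j⟩` and the Gram matrix of a basis. -/
theorem trace_mul_det_gram {V : Type*} [NormedAddCommGroup V] [InnerProductSpace ℝ V]
    (b : Module.Basis (Fin 2) ℝ V) (S : V →ₗ[ℝ] V) :
    LinearMap.trace ℝ V S *
        (inner ℝ (b 0) (b 0) * inner ℝ (b 1) (b 1) - inner ℝ (b 0) (b 1) * inner ℝ (b 0) (b 1)) =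
      inner ℝ (S (b 0)) (b 0) * inner ℝ (b 1) (b 1) + inner ℝ (S (b 1)) (b 1) * inner ℝ (b 0) (b 0)
        - (inner ℝ (S (b 0)) (b 1) + inner ℝ (S (b 1)) (b 0)) * inner ℝ (b 0) (b 1) := by
  rw [LinearMap.trace_eq_matrix_trace ℝ b, Matrix.trace_fin_two]
  have h : ∀ j, S (b j) = LinearMap.toMatrix b b S 0 j • b 0 + LinearMap.toMatrix b b S 1 j • b 1 := by
    intro j
    conv_lhs => rw [← b.sum_repr (S (b j))]
    rw [Fin.sum_univ_two, LinearMap.toMatrix_apply, LinearMap.toMatrix_apply]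
  generalize LinearMap.toMatrix b b S = A at h
  rw [h 0, h 1]
  simp only [inner_add_left, inner_smul_left, real_inner_comm (b 0) (b 1), conj_trivial]
  ring

section ThreeDimensional

variable {M : Type*} [TopologicalSpace M] [ChartedSpace (EuclideanHalfSpace 3) M]
  [IsManifold (𝓡∂ 3) ∞ M]
  [RiemannianBundle (fun x : M => TangentSpace (𝓡∂ 3) x)]
  [IsContMDiffRiemannianBundle (𝓡∂ 3) ∞ (EuclideanSpace ℝ (Fin 3))
    (fun x : M => TangentSpace (𝓡∂ 3) x)]
  {e : OpenPartialHomeomorph M (EuclideanHalfSpace 3)} {p : M}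

theorem finrank_boundaryTangent (p : M) : Module.finrank ℝ (boundaryTangent 3 p) = 2 := by
  have h0 : (boundaryDifferential 3 p p : TangentSpace (𝓡∂ 3) p →ₗ[ℝ] ℝ) ≠ 0 := fun h =>
    (inwardNormal_spec 3 p).2.2.ne' (LinearMap.congr_fun h (inwardNormal 3 p))
  have h1 := Module.Dual.finrank_ker_add_one_of_ne_zero
    (f := (boundaryDifferential 3 p p : TangentSpace (𝓡∂ 3) p →ₗ[ℝ] ℝ)) h0
  have h2 : Module.finrank ℝ (TangentSpace (𝓡∂ 3) p) = 3 :=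
    finrank_euclideanSpace_fin (𝕜 := ℝ) (n := 3)
  rw [h2] at h1
  exact Nat.succ_injective h1

/-- The coordinate fields tangent to the boundary form a basis of its tangent space. -/
theorem IsTypeA.exists_basis_boundaryTangent (he : IsTypeA e)
    (hp : p ∈ e.source ∩ (𝓡∂ 3).boundary M) :
    ∃ b : Module.Basis (Fin 2) ℝ (boundaryTangent 3 p), ∀ i : Fin 2,
      b i = ⟨coordField e i.succ p, he.coordField_mem_boundaryTangent hp i.succ_ne_zero⟩ := by
  have h : LinearIndependent ℝ (fun i : Fin 2 =>
      (⟨coordField e i.succ p, he.coordField_mem_boundaryTangent hp i.succ_ne_zero⟩ :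
        boundaryTangent 3 p)) :=
    LinearIndependent.of_comp (boundaryTangent 3 p).subtype
      ((linearIndependent_coordField he.mem_maximalAtlas hp.1).comp Fin.succ
        (Fin.succ_injective 2))
  have hc : Fintype.card (Fin 2) = Module.finrank ℝ (boundaryTangent 3 p) := by
    rw [finrank_boundaryTangent, Fintype.card_fin]
  refine ⟨basisOfLinearIndependentOfCardEqFinrank h hc, fun i => ?_⟩
  rw [coe_basisOfLinearIndependentOfCardEqFinrank]

theorem mdifferentiableAt_det_metricTensor (he : e ∈ IsManifold.maximalAtlas (𝓡∂ 3) ∞ M)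
    (hp : p ∈ e.source) :
    MDifferentiableAt (𝓡∂ 3) 𝓘(ℝ, ℝ) (fun q => (metricTensor e q).det) p := by
  have hg := mdifferentiableAt_metricTensor he hp
  simp only [Matrix.det_fin_three]
  exact (((((((hg 0 0).mul (hg 1 1)).mul (hg 2 2)).sub (((hg 0 0).mul (hg 1 2)).mul (hg 2 1))).sub
    (((hg 0 1).mul (hg 1 0)).mul (hg 2 2))).add (((hg 0 1).mul (hg 1 2)).mul (hg 2 0))).add
    (((hg 0 2).mul (hg 1 0)).mul (hg 2 1))).sub (((hg 0 2).mul (hg 1 1)).mul (hg 2 0))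

theorem metricTensor_comm (q : M) (i j : Fin 3) :
    metricTensor e q i j = metricTensor e q j i := by
  simp only [metricTensor, Matrix.of_apply]
  exact real_inner_comm _ _

/-- Along the boundary, in Type A coordinates, the determinant of the metric tensor and its
derivatives are those of the tangential block. -/
theorem IsTypeA.det_metricTensor (he : IsTypeA e) (hp : p ∈ e.source ∩ (𝓡∂ 3).boundary M) :
    (metricTensor e p).det = metricTensor e p 1 1 * metricTensor e p 2 2 -
        metricTensor e p 1 2 * metricTensor e p 1 2 ∧
      ∀ v, mvfderiv (𝓡∂ 3) (fun q => (metricTensor e q).det) p v =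
        mvfderiv (𝓡∂ 3) (fun q => metricTensor e q 1 1) p v * metricTensor e p 2 2 +
        mvfderiv (𝓡∂ 3) (fun q => metricTensor e q 2 2) p v * metricTensor e p 1 1 -
        2 * mvfderiv (𝓡∂ 3) (fun q => metricTensor e q 1 2) p v * metricTensor e p 1 2 := by
  have h00 : metricTensor e p 0 0 = 1 := by simp [metricTensor, he.norm_eq_one p hp.1]
  have h01 : metricTensor e p 0 1 = 0 := he.orthogonal p hp 1 (by simp)
  have h02 : metricTensor e p 0 2 = 0 := he.orthogonal p hp 2 (by simp)
  have hdet : ∀ q, (metricTensor e q).det =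
      metricTensor e q 0 0 * (metricTensor e q 1 1 * metricTensor e q 2 2 -
        metricTensor e q 1 2 * metricTensor e q 1 2) +
      metricTensor e q 0 1 * (metricTensor e q 1 2 * metricTensor e q 0 2 +
        metricTensor e q 1 2 * metricTensor e q 0 2 -
        metricTensor e q 0 1 * metricTensor e q 2 2) -
      metricTensor e q 0 2 * (metricTensor e q 0 2 * metricTensor e q 1 1) := by
    intro q
    rw [Matrix.det_fin_three, metricTensor_comm q 1 0, metricTensor_comm q 2 0,
      metricTensor_comm q 2 1]
    ring
  refine ⟨by rw [hdet, h00, h01, h02]; ring, fun v => ?_⟩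
  have d00 := he.mvfderiv_metricTensor_zero_zero hp.1
  have hd := mdifferentiableAt_metricTensor he.mem_maximalAtlas hp.1
  obtain ⟨g, hg⟩ : ∃ g : Fin 3 → Fin 3 → M → ℝ, ∀ i j, g i j = fun q => metricTensor e q i j :=
    ⟨_, fun _ _ => rfl⟩
  have hgp : ∀ i j, metricTensor e p i j = g i j p := fun i j => (congrFun (hg i j) p).symm
  have hfun : (fun q => (metricTensor e q).det) =
      g 0 0 * (g 1 1 * g 2 2 - g 1 2 * g 1 2) +
        g 0 1 * (g 1 2 * g 0 2 + g 1 2 * g 0 2 - g 0 1 * g 2 2) - g 0 2 * (g 0 2 * g 1 1) := by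
    funext q
    rw [hdet]
    simp [hg]
  rw [hfun]
  simp only [← hg, hgp] at hd d00 h00 h01 h02 ⊢
  have a1 := ((hd 1 1).mul (hd 2 2)).sub ((hd 1 2).mul (hd 1 2))
  have a2 := (hd 1 2).mul (hd 0 2)
  have a3 := (a2.add a2).sub ((hd 0 1).mul (hd 2 2))
  have a4 := (hd 0 2).mul (hd 1 1)
  rw [mvfderiv_sub (((hd 0 0).mul a1).add ((hd 0 1).mul a3)) ((hd 0 2).mul a4),
    mvfderiv_add ((hd 0 0).mul a1) ((hd 0 1).mul a3), mvfderiv_mul (hd 0 0) a1,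
    mvfderiv_mul (hd 0 1) a3, mvfderiv_mul (hd 0 2) a4,
    mvfderiv_sub ((hd 1 1).mul (hd 2 2)) ((hd 1 2).mul (hd 1 2)),
    mvfderiv_mul (hd 1 1) (hd 2 2), mvfderiv_mul (hd 1 2) (hd 1 2), d00]
  simp [h00, h01, h02]
  ring

/-- In Type A coordinates, the trace of the shape operator `S_{-ν}` is half the logarithmic normal
derivative of `det (g_ij)`. -/
theorem IsTypeA.trace_shapeOperator (he : IsTypeA e) (hp : p ∈ e.source ∩ (𝓡∂ 3).boundary M) :
    LinearMap.trace ℝ (boundaryTangent 3 p) (shapeOperator 3 p (-inwardNormal 3 p)) *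
        (metricTensor e p).det =
      1 / 2 * mvfderiv (𝓡∂ 3) (fun q => (metricTensor e q).det) p (coordField e 0 p) := by
  obtain ⟨b, hb⟩ := he.exists_basis_boundaryTangent hp
  have ht := trace_mul_det_gram b (shapeOperator 3 p (-inwardNormal 3 p))
  have h11 := he.inner_shapeOperator_coordField hp (i := 1) (j := 1) (by simp) (by simp)
  have h12 := he.inner_shapeOperator_coordField hp (i := 1) (j := 2) (by simp) (by simp)
  have h21 := he.inner_shapeOperator_coordField hp (i := 2) (j := 1) (by simp) (by simp)
  have h22 := he.inner_shapeOperator_coordField hp (i := 2) (j := 2) (by simp) (by simp)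
  simp only [metricTensor_comm _ 2 1] at h21
  obtain ⟨hd, hdv⟩ := he.det_metricTensor hp
  simp only [hb, Submodule.coe_inner, Fin.succ_zero_eq_one, Fin.succ_one_eq_two] at ht
  rw [h11, h12, h21, h22] at ht
  rw [hd, hdv]
  refine ht.trans ?_
  simp only [metricTensor, Matrix.of_apply]
  ring

theorem hasMFDerivAt_volumeDensity (he : e ∈ IsManifold.maximalAtlas (𝓡∂ 3) ∞ M)
    (hp : p ∈ e.source) :
    HasMFDerivAt (𝓡∂ 3) 𝓘(ℝ, ℝ) (volumeDensity e) p
      ((1 / (2 * volumeDensity e p)) •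
        mvfderiv (𝓡∂ 3) (fun q => (metricTensor e q).det) p) := by
  have h1 := (mdifferentiableAt_det_metricTensor he hp).hasMFDerivAt
  have h2 := (Real.hasDerivAt_sqrt (det_metricTensor_pos he hp).ne').hasFDerivAt.hasMFDerivAt
  refine (h2.comp p h1).congr_mfderiv ?_
  ext v
  exact mul_comm (mvfderiv (𝓡∂ 3) (fun q => (metricTensor e q).det) p v)
    (1 / (2 * volumeDensity e p))

end ThreeDimensional

end RiemannianBoundary

end

open RiemannianBoundary in
theorem mainTheorem3 {M : Type*} [TopologicalSpace M] [ChartedSpace (EuclideanHalfSpace 3) M]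
    [IsManifold (𝓡∂ 3) ∞ M]
    [RiemannianBundle (fun x : M => TangentSpace (𝓡∂ 3) x)]
    [IsContMDiffRiemannianBundle (𝓡∂ 3) ∞ (EuclideanSpace ℝ (Fin 3))
      (fun x : M => TangentSpace (𝓡∂ 3) x)] :
    (∀ e : OpenPartialHomeomorph M (EuclideanHalfSpace 3), IsTypeA e →
      ∀ p ∈ e.source ∩ (𝓡∂ 3).boundary M,
        0 < volumeDensity e p ∧
        DifferentiableWithinAt ℝ (volumeDensity e ∘ (e.extend (𝓡∂ 3)).symm)
          (range (𝓡∂ 3)) (e.extend (𝓡∂ 3) p) ∧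
        meanCurvature 3 p = 1 / 2 * tau e p) ∧
    (∀ e e' : OpenPartialHomeomorph M (EuclideanHalfSpace 3), IsTypeA e → IsTypeA e' →
      ∀ p ∈ e.source ∩ e'.source ∩ (𝓡∂ 3).boundary M, tau e p = tau e' p) := by
  have key : ∀ e : OpenPartialHomeomorph M (EuclideanHalfSpace 3), IsTypeA e →
      ∀ p ∈ e.source ∩ (𝓡∂ 3).boundary M, meanCurvature 3 p = 1 / 2 * tau e p := by
    intro e he p hp
    have hA := he.mem_maximalAtlas
    have hdet := det_metricTensor_pos hA hp.1
    have ha : 0 < volumeDensity e p := Real.sqrt_pos.2 hdet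
    have hsq : (metricTensor e p).det = volumeDensity e p * volumeDensity e p :=
      (Real.mul_self_sqrt hdet.le).symm
    have htr := he.trace_shapeOperator hp
    rw [hsq] at htr
    have hv := hasMFDerivAt_volumeDensity hA hp.1
    have htau : tau e p = 1 / (2 * volumeDensity e p) *
        mvfderiv (𝓡∂ 3) (fun q => (metricTensor e q).det) p (coordField e 0 p) /
        volumeDensity e p := by
      rw [tau, coordDeriv_eq hA hp.1 hv.mdifferentiableAt, mvfderiv, hv.mfderiv]
      rfl
    rw [htau, meanCurvature, finrank_boundaryTangent]
    field_simp
    push_cast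
    linear_combination 4 * htr
  refine ⟨fun e he p hp => ⟨?_, ?_, key e he p hp⟩, fun e e' he he' p hp => ?_⟩
  · exact Real.sqrt_pos.2 (det_metricTensor_pos he.mem_maximalAtlas hp.1)
  · exact (hasFDerivWithinAt_comp_extend_symm he.mem_maximalAtlas hp.1
      (hasMFDerivAt_volumeDensity he.mem_maximalAtlas hp.1).mdifferentiableAt
      ).differentiableWithinAt
  · have h := key e he p ⟨hp.1.1, hp.2⟩
    rw [key e' he' p ⟨hp.1.2, hp.2⟩] at h
    linarith
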